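/- Let $(V_n)_{n\ge 1}$ be real numbers and let $C$ satisfy $\liminf_{n\to\infty}V_n>C>0$ (the value $+\infty$ of the $\liminf$ is allowed). Consider the discrete Schrödinger equation $$-(u_{n+1}+u_{n-1}-2u_n)+V_nu_n=0,\qquad n\ge 1,\tag{1}$$ for real sequences $(u_n)_{n\ge 0}$, where no condition is imposed on $u_0$, and put $$K_A:=\sqrt{1+\Big(\frac{2}{C(C+2)}\Big)^2}+\frac{2}{C(C+2)}.$$ A solution $\varphi^-$ of (1) that is not identically zero is called subdominant if $|\varphi^-_n|$ is eventually decreasing (in the weak sense). A subdominant solution exists, and it is unique up to a nonzero constant factor. For every subdominant solution $\varphi^-$ and every integer $m\ge 1$: (a) $\displaystyle\Big(\prod_{\ell=m}^n\frac{V_\ell+2}{K_A}\Big)\varphi^-_n\in\ell^\infty$ as a sequence in $n$; (b) if in addition $\big(n(V_{n+1}-V_n)\big)_n\in\ell^1$, then $\displaystyle\Big(\prod_{\ell=m}^n\frac{V_\ell+2+\sqrt{V_\ell(V_\ell+4)}}{2}\Big)\varphi^-_n\in\ell^\infty$, where $\sqrt{\cdot}$ is the principal complex square root (needed only at the finitely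 many $\ell$ with $V_\ell<0$) and empty products are $1$. Consequently one has the following distances of Agmon type. Let $m\ge 0$ be such that $V_\ell>0$ for all $\ell>m$, and for integers $a,b\ge 0$ put $$d_1(a,b)=\sum_{\ell=\min(a,b)+1}^{\max(a,b)}\big(\ln(V_\ell+2)-\ln K_A\big),\qquad d_2(a,b)=\sum_{\ell=\min(a,b)+1}^{\max(a,b)}\ln\frac{V_\ell+2+\sqrt{V_\ell(V_\ell+4)}}{2}.$$ (c) Every solution $\varphi\in\ell^2$ of (1) satisfies $\big(e^{d_1(m,n)}\varphi_n\big)_{n\ge m}\in\ell^\infty$. If moreover $V_\ell+2>K_A$ for all $\ell>m$, then $d_1$ is a metric on $\{m,m+1,\dots\}$. (d) If $\big(n(V_{n+1}-V_n)\big)_n\in\ell^1$, then every solution $\varphi\in\ell^2$ of (1) satisfies $\big(e^{d_2(m,n)}\varphi_n\big)_{n\ge m}\in\ell^\infty$, and $d_2$ is a metric on $\{m,m+1,\dots\}$. -/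

import Mathlib

open Filter Finset
open scoped ENNReal

noncomputable section

/-- The discrete Laplacian `(Δ u)_n = u_{n+1} + u_{n-1} - 2 u_n`; it is used only for `1 ≤ n`. -/
def discreteLaplacian (u : ℕ → ℝ) (n : ℕ) : ℝ :=
  u (n + 1) + u (n - 1) - 2 * u n

/-- `u` solves `(-Δ + V) u = 0` on the positive integers. The boundary value `u 0` is free,
so that the solution space is two-dimensional. -/
def IsSchrodingerSolution (V u : ℕ → ℝ) : Prop :=
  ∀ n : ℕ, 1 ≤ n → -discreteLaplacian u n + V n * u n = 0

/-- A subdominant solution: a solution, not identically zero, that is eventually decreasing.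
A solution is considered up to a nonzero constant factor, so decrease refers to its modulus
(otherwise a negative multiple of a growing solution would count). -/
def IsSubdominant (V φ : ℕ → ℝ) : Prop :=
  IsSchrodingerSolution V φ ∧ φ ≠ 0 ∧ ∃ N : ℕ, AntitoneOn (fun n => |φ n|) (Set.Ici N)

/-- The constant `K_A`, as a function of `C`. -/
def agmonConst (C : ℝ) : ℝ :=
  √(1 + (2 / (C * (C + 2))) ^ 2) + 2 / (C * (C + 2))

/-- The factor `(v + 2 + √(v (v + 4))) / 2`, with the principal complex square root, so that it
has its intended value also for `v (v + 4) < 0`. -/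
def growthFactor (v : ℝ) : ℂ :=
  ((v : ℂ) + 2 + ((v : ℂ) * ((v : ℂ) + 4)) ^ (1 / 2 : ℂ)) / 2

/-- The additive symmetric function on the lattice with weights `w`: for `a ≤ b` it is
`∑_{ℓ = a + 1}^{b} w ℓ`. -/
def latticeDist (w : ℕ → ℝ) (a b : ℕ) : ℝ :=
  ∑ ℓ ∈ Finset.Ioc (min a b) (max a b), w ℓ

/-- `d` is a metric on the lattice half-line `{m, m + 1, …}`. -/
def IsMetricFrom (m : ℕ) (d : ℕ → ℕ → ℝ) : Prop :=
  (∀ a b : ℕ, m ≤ a → m ≤ b → 0 ≤ d a b) ∧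
  (∀ a b : ℕ, m ≤ a → m ≤ b → (d a b = 0 ↔ a = b)) ∧
  (∀ a b : ℕ, m ≤ a → m ≤ b → d a b = d b a) ∧
  (∀ a b c : ℕ, m ≤ a → m ≤ b → m ≤ c → d a c ≤ d a b + d b c)

/-- The Agmon decay property: every `ℓ²` solution `φ` satisfies `e^{d(m,n)} φ_n ∈ ℓ^∞`. -/
def HasAgmonDecay (V : ℕ → ℝ) (m : ℕ) (d : ℕ → ℕ → ℝ) : Prop :=
  ∀ φ : ℕ → ℝ, IsSchrodingerSolution V φ → Memℓp φ 2 →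
    Memℓp (fun n : ℕ => Real.exp (d m n) * φ n) ∞

end

open Topology

/-! ### Linear recurrence: solutions, Wronskian, fundamental systems -/

/-! Eventually `V > C > 0`, so a solution that is once nonnegative and nondecreasing grows from then
on. Among the others there is, up to a factor, one positive decreasing solution `φ`, obtained by
minimality (`exists_fundamentalSystem`). An independent solution tends to infinity, so every bounded
solution, in particular every subdominant or `ℓ²` one, is a multiple of `φ` (`eq_smul_of_bounded`),
and all bounds need only be proved for `φ`.

For (a), `(V (n+1) + 2) φ (n+1) = φ n + φ (n+2)`, and decrease forces `φ (n+2) ≤ φ n / (C+1)²`;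
since `1 + 1/(C+1)² ≤ K_A`, each new factor of the product costs nothing.

For (b), the ratio `r n = φ (n+1) / φ n` satisfies the Riccati equation `r n = 1 / (V (n+1) + 2 - r
(n+1))`, whose fixed point for frozen `V` is the inverse growth factor. Read backwards the equation
is a contraction, so the distance from `r` to this fixed point is summable once `V` has bounded
variation, and the product of growth factors times ratios stays bounded. -/

theorem isSchrodingerSolution_iff {V u : ℕ → ℝ} :
    IsSchrodingerSolution V u ↔ ∀ n, u (n + 2) = (V (n + 1) + 2) * u (n + 1) - u n := by
  constructor
  · intro h n
    have := h (n + 1) (by omega)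
    simp only [discreteLaplacian, Nat.add_sub_cancel] at this
    linarith
  · intro h n hn
    obtain ⟨k, rfl⟩ : ∃ k, n = k + 1 := ⟨n - 1, by omega⟩
    have := h k
    simp only [discreteLaplacian, Nat.add_sub_cancel]
    rw [this]
    ring

theorem IsSchrodingerSolution.linearCombination {V u v : ℕ → ℝ} (hu : IsSchrodingerSolution V u)
    (hv : IsSchrodingerSolution V v) (a b : ℝ) :
    IsSchrodingerSolution V (fun n => a * u n + b * v n) := by
  rw [isSchrodingerSolution_iff] at *
  intro n
  simp only [hu n, hv n]
  ring

/-- The Wronskian of two sequences. -/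
def wronskian (u v : ℕ → ℝ) (n : ℕ) : ℝ :=
  u n * v (n + 1) - u (n + 1) * v n

theorem wronskian_eq {V u v : ℕ → ℝ} (hu : IsSchrodingerSolution V u)
    (hv : IsSchrodingerSolution V v) (m n : ℕ) : wronskian u v m = wronskian u v n := by
  rw [isSchrodingerSolution_iff] at hu hv
  have key : ∀ k, wronskian u v k = wronskian u v 0 := by
    intro k
    induction k with
    | zero => rfl
    | succ k ih =>
      rw [← ih]
      simp only [wronskian, add_assoc, Nat.reduceAdd, hu k, hv k]
      ring
  rw [key m, key n]

theorem eq_linearCombination {V u v w : ℕ → ℝ} (hu : IsSchrodingerSolution V u)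
    (hv : IsSchrodingerSolution V v) (hw : IsSchrodingerSolution V w)
    (h1 : ∀ n, wronskian u v n = 1) : ∃ a b : ℝ, ∀ n, w n = a * u n + b * v n := by
  -- Cramer's rule; the coefficients are constant, so they may be evaluated at `n`.
  refine ⟨wronskian w v 0, wronskian u w 0, fun n => ?_⟩
  rw [wronskian_eq hw hv 0 n, wronskian_eq hu hw 0 n]
  have := h1 n
  simp only [wronskian] at *
  linear_combination -(w n) * this

theorem exists_solution (V : ℕ → ℝ) (N : ℕ) (a b : ℝ) :
    ∃ u, IsSchrodingerSolution V u ∧ u N = a ∧ u (N + 1) = b := by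
  induction N generalizing a b with
  | zero =>
    let f : ℕ → ℝ × ℝ := fun n =>
      Nat.rec (a, b) (fun n p => (p.2, (V (n + 1) + 2) * p.2 - p.1)) n
    exact ⟨fun n => (f n).1, isSchrodingerSolution_iff.2 fun n => rfl, rfl, rfl⟩
  | succ N ih =>
    -- The recurrence is reversible: the data are pulled back one step.
    obtain ⟨u, hu, h0, h1⟩ := ih ((V (N + 1) + 2) * a - b) a
    refine ⟨u, hu, h1, ?_⟩
    rw [isSchrodingerSolution_iff.1 hu N, h0, h1]
    ring

/-- Discrete convexity: each increment exceeds the previous one by `V w`, which is nonnegative as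
long as `w` is. -/
theorem IsSchrodingerSolution.increasing {V w : ℕ → ℝ} (hw : IsSchrodingerSolution V w) {n : ℕ}
    (hV : ∀ k, n < k → 0 ≤ V k) (h0 : 0 ≤ w n) (h1 : w n ≤ w (n + 1)) (k : ℕ) (hk : n ≤ k) :
    0 ≤ w k ∧ w (n + 1) - w n ≤ w (k + 1) - w k := by
  induction k, hk using Nat.le_induction with
  | base => exact ⟨h0, le_rfl⟩
  | succ k hk ih =>
    have h2 : 0 ≤ w (k + 1) := by linarith
    refine ⟨h2, ?_⟩
    rw [isSchrodingerSolution_iff.1 hw k]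
    nlinarith [mul_nonneg (hV (k + 1) (by omega)) h2]

/-- With `u` growing and `v` independent of it, `v / u` increases to a limit `L`, and `L u - v` is
the minimal solution. -/
theorem exists_fundamentalSystem {V : ℕ → ℝ} {N : ℕ} (hV : ∀ n, N ≤ n → 0 ≤ V n) :
    ∃ φ u : ℕ → ℝ, IsSchrodingerSolution V φ ∧ IsSchrodingerSolution V u ∧
      (∀ n, wronskian φ u n = 1) ∧ (∀ n, N ≤ n → 0 < φ n) ∧
      (∀ n, N ≤ n → φ (n + 1) ≤ φ n) ∧ Tendsto u atTop atTop := by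
  -- These data give `u` increments at least `1`, Wronskian `1`, and `u - v` starting from `1, 1`,
  -- whence `v ≤ u`.
  obtain ⟨u, hu, hu0, hu1⟩ := exists_solution V N 1 2
  obtain ⟨v, hv, hv0, hv1⟩ := exists_solution V N 0 1
  have hV' : ∀ k, N < k → 0 ≤ V k := fun k hk => hV k hk.le
  have hui := hu.increasing hV' (by rw [hu0]; norm_num) (by rw [hu0, hu1]; norm_num)
  have huge : ∀ k, N ≤ k → (k : ℝ) - N + 1 ≤ u k := by
    intro k hk
    induction k, hk using Nat.le_induction with
    | base => rw [hu0]; linarith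
    | succ k hk ih =>
      have := (hui k hk).2
      push_cast
      linarith
  have hupos : ∀ k, N ≤ k → 0 < u k := fun k hk => by
    have := huge k hk
    have : (N : ℝ) ≤ k := by exact_mod_cast hk
    linarith
  have hvu : ∀ k, N ≤ k → v k ≤ u k := by
    intro k hk
    have := ((hu.linearCombination hv 1 (-1)).increasing hV' (by simp [hu0, hv0])
      (by simp only [hu0, hv0, hu1, hv1]; norm_num) k hk).1
    linarith
  have hW : ∀ n, wronskian u v n = 1 := fun n => by
    rw [wronskian_eq hu hv n N]
    simp [wronskian, hu0, hv0, hv1]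
  let s : ℕ → ℝ := fun n => v (N + n) / u (N + n)
  have hs : StrictMono s := strictMono_nat_of_lt_succ fun n => by
    have h1 := hupos (N + n) (by omega)
    have h2 := hupos (N + n + 1) (by omega)
    have h3 := hW (N + n)
    simp only [wronskian] at h3
    change v (N + n) / u (N + n) < v (N + n + 1) / u (N + n + 1)
    rw [div_lt_div_iff₀ h1 h2]
    linarith
  have hbdd : BddAbove (Set.range s) := by
    refine ⟨1, ?_⟩
    rintro _ ⟨n, rfl⟩
    exact (div_le_one (hupos _ (by omega))).2 (hvu _ (by omega))
  set L := ⨆ n, s n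
  have hlim : Tendsto s atTop (𝓝 L) := tendsto_atTop_ciSup hs.monotone hbdd
  have hsL : ∀ n, s n < L := fun n => (hs (Nat.lt_succ_self n)).trans_le (le_ciSup hbdd (n + 1))
  have hφ := hu.linearCombination hv L (-1)
  have hφpos : ∀ n, N ≤ n → 0 < L * u n + -1 * v n := by
    intro n hn
    have h1 := hsL (n - N)
    simp only [s, Nat.add_sub_of_le hn] at h1
    rw [div_lt_iff₀ (hupos n hn)] at h1
    linarith
  refine ⟨_, u, hφ, hu, ?_, hφpos, ?_, ?_⟩
  · intro n
    have := hW n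
    simp only [wronskian] at *
    linarith
  · intro n hn
    by_contra! hlt
    -- If `φ` rose at `n`, then `φ - ε u` would start nonnegative and nondecreasing there and stay
    -- nonnegative, which caps `v / u` at `L - ε`.
    obtain ⟨ε, hε, hε1, hε2⟩ : ∃ ε > 0, ε * u n ≤ L * u n + -1 * v n ∧
        ε * (u (n + 1) - u n) ≤ (L * u (n + 1) + -1 * v (n + 1)) - (L * u n + -1 * v n) := by
      have hd : 0 < u (n + 1) - u n := by
        have := (hui n hn).2
        rw [hu1, hu0] at this
        linarith
      refine ⟨min ((L * u n + -1 * v n) / u n) (((L * u (n + 1) + -1 * v (n + 1)) -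
        (L * u n + -1 * v n)) / (u (n + 1) - u n)), ?_, ?_, ?_⟩
      · exact lt_min (div_pos (hφpos n hn) (hupos n hn)) (div_pos (by linarith) hd)
      · rw [← le_div_iff₀ (hupos n hn)]
        exact min_le_left _ _
      · rw [← le_div_iff₀ hd]
        exact min_le_right _ _
    have hinc := (hφ.linearCombination hu 1 (-ε)).increasing (n := n)
      (fun k hk => hV k (by omega)) (by linarith) (by linarith)
    have hle : L ≤ L - ε := by
      refine le_of_tendsto hlim ?_
      filter_upwards [eventually_ge_atTop n] with k hk
      have h1 := (hinc (N + k) (by omega)).1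
      change v (N + k) / u (N + k) ≤ _
      rw [div_le_iff₀ (hupos _ (by omega))]
      linarith
    linarith
  · refine tendsto_atTop_mono' _ ?_
      (tendsto_atTop_add_const_right _ (1 - (N : ℝ)) tendsto_natCast_atTop_atTop)
    filter_upwards [eventually_ge_atTop N] with k hk
    have := huge k hk
    linarith

/-- A solution that is bounded along a neighbourhood of infinity is a multiple of the decreasing
solution of a fundamental system. -/
theorem eq_smul_of_bounded {V φ u ψ : ℕ → ℝ} {N : ℕ} (hφ : IsSchrodingerSolution V φ)
    (hu : IsSchrodingerSolution V u) (hW : ∀ n, wronskian φ u n = 1)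
    (hpos : ∀ n, N ≤ n → 0 < φ n) (hanti : ∀ n, N ≤ n → φ (n + 1) ≤ φ n)
    (htop : Tendsto u atTop atTop) (hψ : IsSchrodingerSolution V ψ)
    {B : ℝ} (hB : ∀ᶠ n in atTop, |ψ n| ≤ B) : ∃ c : ℝ, ψ = c • φ := by
  obtain ⟨a, b, hab⟩ := eq_linearCombination hφ hu hψ hW
  have hle : ∀ n, N ≤ n → |φ n| ≤ φ N := by
    intro n hn
    rw [abs_of_pos (hpos n hn)]
    induction n, hn using Nat.le_induction with
    | base => exact le_rfl
    | succ n hn ih => exact (hanti n hn).trans ih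
  have hb : b = 0 := by
    by_contra hb
    have hbt : Tendsto (fun n => |b| * u n) atTop atTop :=
      htop.const_mul_atTop (abs_pos.2 hb)
    obtain ⟨n, h1, h2, h3⟩ := ((hbt.eventually_gt_atTop (B + |a| * φ N)).and
      (hB.and (eventually_ge_atTop N))).exists
    have h4 : |b| * u n ≤ |ψ n| + |a| * |φ n| := by
      calc |b| * u n ≤ |b| * |u n| := by gcongr; exact le_abs_self _
        _ = |ψ n - a * φ n| := by rw [← abs_mul, hab n]; congr 1; ring
        _ ≤ |ψ n| + |a * φ n| := abs_sub _ _
        _ = _ := by rw [abs_mul]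
    have h5 : |a| * |φ n| ≤ |a| * φ N := by gcongr; exact hle n h3
    linarith
  exact ⟨a, funext fun n => by simp [hab n, hb]⟩

/-! ### Bounded products -/

theorem memℓp_infty_of_eventually_le {E : Type*} [NormedAddCommGroup E] {f : ℕ → E} {B : ℝ}
    (h : ∀ᶠ n in atTop, ‖f n‖ ≤ B) : Memℓp f ∞ := by
  rw [memℓp_infty_iff]
  have h1 : IsBoundedUnder (· ≤ ·) atTop fun n => ‖f n‖ := ⟨B, by simpa using h⟩
  exact h1.bddAbove_range

/-- One step multiplies the norm by at most `exp (ε n)`, so the total growth past `max N m` is at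
most `exp (∑ ε)`. -/
theorem memℓp_prod_mul {𝕜 : Type*} [NormedField 𝕜] {g f : ℕ → 𝕜} {ε : ℕ → ℝ} {N : ℕ}
    (hε0 : ∀ n, 0 ≤ ε n) (hε : Summable ε)
    (h : ∀ n, N ≤ n → ‖g (n + 1) * f (n + 1)‖ ≤ Real.exp (ε n) * ‖f n‖) (m : ℕ) :
    Memℓp (fun n => (∏ ℓ ∈ Finset.Icc m n, g ℓ) * f n) ∞ := by
  set M := max N m
  set P : ℕ → ℝ := fun n => ‖(∏ ℓ ∈ Finset.Icc m n, g ℓ) * f n‖ with hP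
  have hPn : ∀ n, M ≤ n → P n ≤ P M * Real.exp (∑ k ∈ Finset.Ico M n, ε k) := by
    intro n hn
    induction n, hn using Nat.le_induction with
    | base => simp
    | succ n hn ih =>
      have hm : m ≤ n + 1 := ((le_max_right N m).trans hn).trans (Nat.le_succ n)
      rw [Finset.sum_Ico_succ_top hn, Real.exp_add, ← mul_assoc]
      calc P (n + 1) = ‖∏ ℓ ∈ Finset.Icc m n, g ℓ‖ * ‖g (n + 1) * f (n + 1)‖ := by
            simp only [hP]
            rw [Finset.prod_Icc_succ_top hm, mul_assoc, norm_mul]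
        _ ≤ ‖∏ ℓ ∈ Finset.Icc m n, g ℓ‖ * (Real.exp (ε n) * ‖f n‖) := by
            gcongr
            exact h n ((le_max_left N m).trans hn)
        _ = P n * Real.exp (ε n) := by simp only [hP, norm_mul]; ring
        _ ≤ _ := by gcongr
  refine memℓp_infty_of_eventually_le (B := P M * Real.exp (∑' k, ε k)) ?_
  filter_upwards [eventually_ge_atTop M] with n hn
  refine (hPn n hn).trans ?_
  have : ∑ k ∈ Finset.Ico M n, ε k ≤ ∑' k, ε k := hε.sum_le_tsum _ fun k _ => hε0 k
  have hPM : 0 ≤ P M := norm_nonneg _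
  gcongr

/-! ### The bound with the constant `agmonConst` -/

theorem one_add_le_agmonConst {C : ℝ} (hC : 0 < C) : 1 + 1 / (C + 1) ^ 2 ≤ agmonConst C := by
  have h1 : 1 ≤ √(1 + (2 / (C * (C + 2))) ^ 2) := by
    rw [Real.one_le_sqrt]
    nlinarith [sq_nonneg (2 / (C * (C + 2)))]
  have h2 : 1 / (C + 1) ^ 2 ≤ 2 / (C * (C + 2)) := by
    rw [div_le_div_iff₀ (by positivity) (by positivity)]
    nlinarith
  unfold agmonConst
  linarith

theorem agmonConst_pos {C : ℝ} (hC : 0 < C) : 0 < agmonConst C :=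
  lt_of_lt_of_le (by positivity) (one_add_le_agmonConst hC)

section Decreasing

variable {V φ : ℕ → ℝ} {C : ℝ} {N : ℕ}

/-- The recurrence gives `φ n - (V (n+1) + 1) φ (n+1) = φ (n+1) - φ (n+2) ≥ 0`. -/
theorem mul_succ_le_of_decreasing (hV : ∀ n, N ≤ n → C < V n)
    (hφ : IsSchrodingerSolution V φ) (hpos : ∀ n, N ≤ n → 0 < φ n)
    (hanti : ∀ n, N ≤ n → φ (n + 1) ≤ φ n) {n : ℕ} (hn : N ≤ n) :
    (C + 1) * φ (n + 1) ≤ φ n := by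
  have h1 := isSchrodingerSolution_iff.1 hφ n
  have h2 := hanti (n + 1) (by omega)
  have h3 := hpos (n + 1) (by omega)
  have h4 := mul_pos (sub_pos.2 (hV (n + 1) (by omega))) h3
  simp only [add_assoc, Nat.reduceAdd] at h2
  nlinarith

theorem potential_mul_succ_le (hC : 0 < C) (hV : ∀ n, N ≤ n → C < V n)
    (hφ : IsSchrodingerSolution V φ) (hpos : ∀ n, N ≤ n → 0 < φ n)
    (hanti : ∀ n, N ≤ n → φ (n + 1) ≤ φ n) {n : ℕ} (hn : N ≤ n) :
    (V (n + 1) + 2) * φ (n + 1) ≤ agmonConst C * φ n := by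
  have h1 := isSchrodingerSolution_iff.1 hφ n
  have h2 := mul_succ_le_of_decreasing hV hφ hpos hanti hn
  have h3 := mul_succ_le_of_decreasing hV hφ hpos hanti (n := n + 1) (by omega)
  have h4 : φ (n + 2) ≤ 1 / (C + 1) ^ 2 * φ n := by
    rw [div_mul_eq_mul_div, one_mul, le_div_iff₀ (by positivity)]
    simp only [add_assoc, Nat.reduceAdd] at h3
    nlinarith
  have h5 := mul_le_mul_of_nonneg_right (one_add_le_agmonConst hC) (hpos n hn).le
  linarith

theorem memℓp_prod_div_agmonConst (hC : 0 < C) (hV : ∀ n, N ≤ n → C < V n)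
    (hφ : IsSchrodingerSolution V φ) (hpos : ∀ n, N ≤ n → 0 < φ n)
    (hanti : ∀ n, N ≤ n → φ (n + 1) ≤ φ n) (m : ℕ) :
    Memℓp (fun n => (∏ ℓ ∈ Finset.Icc m n, (V ℓ + 2) / agmonConst C) * φ n) ∞ := by
  refine memℓp_prod_mul (ε := fun _ => 0) (N := N) (fun _ => le_rfl) summable_zero ?_ m
  intro n hn
  have hK := agmonConst_pos hC
  have h1 := hpos n hn
  have h2 := hpos (n + 1) (by omega)
  have h3 := hV (n + 1) (by omega)
  have h4 : 0 < V (n + 1) + 2 := by linarith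
  rw [Real.norm_of_nonneg (by positivity), Real.norm_of_nonneg h1.le, Real.exp_zero, one_mul,
    div_mul_eq_mul_div, div_le_iff₀ hK, mul_comm (φ n)]
  exact potential_mul_succ_le hC hV hφ hpos hanti hn

end Decreasing

/-! ### The WKB bound -/

/-- The larger root of `x + x⁻¹ = v + 2`, for `0 ≤ v`. -/
noncomputable def realGrowthFactor (v : ℝ) : ℝ :=
  (v + 2 + √(v * (v + 4))) / 2

theorem growthFactor_eq_ofReal {v : ℝ} (hv : 0 ≤ v) : growthFactor v = realGrowthFactor v := by
  have h : ((v : ℂ) * ((v : ℂ) + 4)) ^ (1 / 2 : ℂ) = ((√(v * (v + 4)) : ℝ) : ℂ) := by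
    rw [Real.sqrt_eq_rpow, Complex.ofReal_cpow (by positivity)]
    push_cast
    rfl
  rw [growthFactor, h, realGrowthFactor]
  push_cast
  rfl

theorem realGrowthFactor_ge {v : ℝ} : (v + 2) / 2 ≤ realGrowthFactor v := by
  unfold realGrowthFactor
  linarith [Real.sqrt_nonneg (v * (v + 4))]

theorem realGrowthFactor_pos {v : ℝ} (hv : 0 ≤ v) : 0 < realGrowthFactor v :=
  lt_of_lt_of_le (by linarith) realGrowthFactor_ge

theorem one_lt_realGrowthFactor {v : ℝ} (hv : 0 < v) : 1 < realGrowthFactor v :=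
  lt_of_lt_of_le (by linarith) realGrowthFactor_ge

theorem realGrowthFactor_add_inv {v : ℝ} (hv : 0 ≤ v) :
    realGrowthFactor v + (realGrowthFactor v)⁻¹ = v + 2 := by
  have h := Real.sq_sqrt (show 0 ≤ v * (v + 4) by positivity)
  have h0 := (realGrowthFactor_pos hv).ne'
  have h1 : realGrowthFactor v ^ 2 + 1 = (v + 2) * realGrowthFactor v := by
    unfold realGrowthFactor
    nlinarith
  field_simp
  linarith

/-- Summing the inequality, the shift changes a partial sum of `e` by at most `B`; as `ρ < 1`, the
sum is absorbed on the left. -/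
theorem summable_of_contraction {e δ : ℕ → ℝ} {ρ B : ℝ} (hρ0 : 0 ≤ ρ) (hρ : ρ < 1)
    (he : ∀ n, 0 ≤ e n) (heB : ∀ n, e n ≤ B) (hδ0 : ∀ n, 0 ≤ δ n) (hδ : Summable δ)
    (h : ∀ n, e n ≤ ρ * (e (n + 1) + δ n)) : Summable e := by
  refine summable_of_sum_range_le (c := ρ * (B + ∑' k, δ k) / (1 - ρ)) he fun n => ?_
  rw [le_div_iff₀ (by linarith)]
  have h1 : ∑ k ∈ Finset.range n, e k ≤
      ρ * (∑ k ∈ Finset.range n, e (k + 1) + ∑ k ∈ Finset.range n, δ k) := by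
    rw [← Finset.sum_add_distrib, Finset.mul_sum]
    exact Finset.sum_le_sum fun k _ => h k
  have h2 : ∑ k ∈ Finset.range n, δ k ≤ ∑' k, δ k := hδ.sum_le_tsum _ fun k _ => hδ0 k
  have h3 : ∑ k ∈ Finset.range n, e (k + 1) ≤ ∑ k ∈ Finset.range n, e k + B := by
    have h4 := Finset.sum_range_succ e n
    rw [Finset.sum_range_succ'] at h4
    linarith [he 0, heB n]
  have h5 : ρ * (∑ k ∈ Finset.range n, e (k + 1) + ∑ k ∈ Finset.range n, δ k) ≤
      ρ * ((∑ k ∈ Finset.range n, e k + B) + ∑' k, δ k) := by gcongr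
  linarith

theorem summable_abs_succ_sub {V : ℕ → ℝ}
    (h : Memℓp (fun n : ℕ => (n : ℝ) * (V (n + 1) - V n)) 1) :
    Summable fun n => |V (n + 1) - V n| := by
  have h1 : Summable fun n : ℕ => |(n : ℝ) * (V (n + 1) - V n)| := by
    simpa using h.summable (by simp)
  -- The weight `n` vanishes at `0`; past it, it is at least `1`.
  rw [← summable_nat_add_iff 1] at h1 ⊢
  refine Summable.of_nonneg_of_le (fun _ => abs_nonneg _) (fun n => ?_) h1
  rw [abs_mul, Nat.abs_cast]
  refine le_mul_of_one_le_left (abs_nonneg _) ?_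
  push_cast
  linarith [(Nat.cast_nonneg n : (0 : ℝ) ≤ n)]

theorem exists_le_of_summable_abs_succ_sub {V : ℕ → ℝ}
    (h : Summable fun n => |V (n + 1) - V n|) : ∃ B, ∀ n, V n ≤ B := by
  have h1 : CauchySeq V := cauchySeq_of_summable_dist (by
    simpa only [Real.dist_eq, abs_sub_comm] using h)
  obtain ⟨B, hB⟩ := h1.isBounded_range.bddAbove
  exact ⟨B, fun n => hB ⟨n, rfl⟩⟩

/-- Two fixed points `x = 1 / (W - x)` in `(0, ρ]` depend Lipschitz continuously on `W`. -/
theorem abs_inv_sub_inv_le {x y ρ : ℝ} (hρ : ρ < 1) (hx : 0 < x) (hy : 0 < y)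
    (hxρ : x⁻¹ ≤ ρ) (hyρ : y⁻¹ ≤ ρ) :
    |x⁻¹ - y⁻¹| ≤ (1 - ρ)⁻¹ * |(x + x⁻¹) - (y + y⁻¹)| := by
  have hx' := inv_pos.2 hx
  have hy' := inv_pos.2 hy
  have h1 : x⁻¹ * y⁻¹ ≤ ρ := by nlinarith
  have h2 : x⁻¹ * y⁻¹ * ((x + x⁻¹) - (y + y⁻¹)) = -((1 - x⁻¹ * y⁻¹) * (x⁻¹ - y⁻¹)) := by
    field_simp
    ring
  have h3 : x⁻¹ * y⁻¹ * |(x + x⁻¹) - (y + y⁻¹)| = (1 - x⁻¹ * y⁻¹) * |x⁻¹ - y⁻¹| := by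
    have := congrArg abs h2
    rwa [abs_mul (x⁻¹ * y⁻¹), abs_neg, abs_mul (1 - x⁻¹ * y⁻¹), abs_of_pos (mul_pos hx' hy'),
      abs_of_pos (a := 1 - x⁻¹ * y⁻¹) (by linarith)] at this
  rw [inv_mul_eq_div, le_div_iff₀ (by linarith)]
  nlinarith [abs_nonneg (x⁻¹ - y⁻¹), abs_nonneg ((x + x⁻¹) - (y + y⁻¹))]

/-- Subtracting the two equations gives `r - q = r q (r' - q)`; here `q'` is the next fixed point,
so `q' - q` is the drift due to the variation of `V`. -/
theorem abs_sub_le_of_riccati {r r' q q' W ρ : ℝ} (hρ : ρ ≤ 1) (hr : 0 < r) (hq : 0 < q)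
    (hrρ : r ≤ ρ) (hqρ : q ≤ ρ) (h1 : r * (W - r') = 1) (h2 : q * (W - q) = 1) :
    |r - q| ≤ ρ * (|r' - q'| + |q' - q|) := by
  have h3 : r - q = r * q * ((r' - q') + (q' - q)) := by
    linear_combination q * h1 - r * h2
  have h4 : r * q ≤ ρ := by nlinarith
  rw [h3, abs_mul, abs_of_pos (mul_pos hr hq)]
  exact mul_le_mul h4 (abs_add_le _ _) (abs_nonneg _) (by linarith)

theorem memℓp_prod_growthFactor {V φ : ℕ → ℝ} {C : ℝ} {N : ℕ} (hC : 0 < C)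
    (hV : ∀ n, N ≤ n → C < V n) (hφ : IsSchrodingerSolution V φ)
    (hpos : ∀ n, N ≤ n → 0 < φ n) (hanti : ∀ n, N ≤ n → φ (n + 1) ≤ φ n)
    (hsum : Summable fun n => |V (n + 1) - V n|) (m : ℕ) :
    Memℓp (fun n => (∏ ℓ ∈ Finset.Icc m n, growthFactor (V ℓ)) * (φ n : ℂ)) ∞ := by
  obtain ⟨B, hB⟩ := exists_le_of_summable_abs_succ_sub hsum
  -- A common bound for the ratios, at most `1/(C+1)`, and for the inverse growth factors, since
  -- these factors are at least `(V+2)/2`.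
  set ρ : ℝ := 2 / (C + 2) with hρdef
  have hρ0 : 0 < ρ := by positivity
  have hρ1 : ρ < 1 := by rw [hρdef, div_lt_one (by positivity)]; linarith
  set g : ℕ → ℝ := fun n => realGrowthFactor (V (n + 1)) with hg
  set r : ℕ → ℝ := fun n => φ (n + 1) / φ n with hr
  have hVn : ∀ n, N ≤ n → 0 ≤ V (n + 1) := fun n hn => (hC.trans (hV _ (by omega))).le
  have hgpos : ∀ n, N ≤ n → 0 < g n := fun n hn => realGrowthFactor_pos (hVn n hn)
  have hgρ : ∀ n, N ≤ n → (g n)⁻¹ ≤ ρ := by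
    intro n hn
    rw [hρdef, ← inv_div]
    refine inv_anti₀ (by positivity) (le_trans ?_ realGrowthFactor_ge)
    linarith [hV (n + 1) (by omega)]
  have hgB : ∀ n, N ≤ n → g n ≤ B + 2 := by
    intro n hn
    have h1 := realGrowthFactor_add_inv (hVn n hn)
    have h2 := inv_pos.2 (hgpos n hn)
    have h3 := hB (n + 1)
    simp only [hg] at *
    linarith
  have hrpos : ∀ n, N ≤ n → 0 < r n := fun n hn => div_pos (hpos _ (by omega)) (hpos n hn)
  have hrρ : ∀ n, N ≤ n → r n ≤ ρ := by
    intro n hn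
    have h1 := mul_succ_le_of_decreasing hV hφ hpos hanti hn
    have h2 := hpos (n + 1) (by omega)
    rw [hρdef, hr, div_le_div_iff₀ (hpos n hn) (by positivity)]
    nlinarith
  have hric : ∀ n, N ≤ n → r n * ((V (n + 1) + 2) - r (n + 1)) = 1 := by
    intro n hn
    have h1 := (hpos n hn).ne'
    have h2 := (hpos (n + 1) (by omega)).ne'
    simp only [hr, add_assoc, Nat.reduceAdd, isSchrodingerSolution_iff.1 hφ n]
    field_simp
    ring
  have hfix : ∀ n, N ≤ n → (g n)⁻¹ * ((V (n + 1) + 2) - (g n)⁻¹) = 1 := by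
    intro n hn
    rw [← realGrowthFactor_add_inv (hVn n hn)]
    have := (hgpos n hn).ne'
    simp only [hg] at *
    field_simp
    ring
  have hesum : Summable fun n => |r n - (g n)⁻¹| := by
    refine (summable_nat_add_iff N).1 ?_
    refine summable_of_contraction (δ := fun n => |(g (n + N + 1))⁻¹ - (g (n + N))⁻¹|)
      (B := 1) hρ0.le hρ1 (fun _ => abs_nonneg _) ?_ (fun _ => abs_nonneg _) ?_ ?_
    · intro n
      have hn : N ≤ n + N := by omega
      have h1 := hrpos _ hn
      have h2 := hrρ _ hn
      have h3 := hgρ _ hn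
      have h4 := inv_pos.2 (hgpos _ hn)
      exact abs_le.2 ⟨by linarith, by linarith⟩
    · have h1 : Summable fun n => |V (n + (N + 1) + 1) - V (n + (N + 1))| :=
        (summable_nat_add_iff (f := fun n => |V (n + 1) - V n|) (N + 1)).2 hsum
      refine Summable.of_nonneg_of_le (fun _ => abs_nonneg _) (fun n => ?_)
        (h1.mul_left (1 - ρ)⁻¹)
      have hn : N ≤ n + N := by omega
      have hn' : N ≤ n + N + 1 := by omega
      have h2 := abs_inv_sub_inv_le hρ1 (hgpos _ hn') (hgpos _ hn) (hgρ _ hn') (hgρ _ hn)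
      rw [realGrowthFactor_add_inv (hVn _ hn), realGrowthFactor_add_inv (hVn _ hn'),
        add_sub_add_right_eq_sub] at h2
      exact h2
    · intro n
      have hn : N ≤ n + N := by omega
      rw [show n + 1 + N = n + N + 1 by omega]
      exact abs_sub_le_of_riccati hρ1.le (hrpos _ hn) (inv_pos.2 (hgpos _ hn)) (hrρ _ hn)
        (hgρ _ hn) (hric _ hn) (hfix _ hn)
  have hB2 : 0 ≤ B + 2 := (hgpos N le_rfl).le.trans (hgB N le_rfl)
  refine memℓp_prod_mul (ε := fun n => (B + 2) * |r n - (g n)⁻¹|) (N := N)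
    (fun n => by positivity) (hesum.mul_left _) ?_ m
  intro n hn
  have h0 := hgpos n hn
  have h1 : ‖growthFactor (V (n + 1)) * (φ (n + 1) : ℂ)‖ = (g n * r n) * φ n := by
    rw [growthFactor_eq_ofReal (hVn n hn), ← Complex.ofReal_mul, Complex.norm_real,
      Real.norm_of_nonneg (mul_nonneg h0.le (hpos _ (by omega)).le), mul_assoc, hr,
      div_mul_cancel₀ _ (hpos n hn).ne']
  rw [h1, Complex.norm_real, Real.norm_of_nonneg (hpos n hn).le]
  refine mul_le_mul_of_nonneg_right ?_ (hpos n hn).le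
  -- The excess of `g n * r n` over `1` is summable, and `1 + x ≤ exp x`.
  have h2 : g n * r n = g n * (r n - (g n)⁻¹) + 1 := by
    rw [mul_sub, mul_inv_cancel₀ h0.ne']
    ring
  have h3 : g n * (r n - (g n)⁻¹) ≤ (B + 2) * |r n - (g n)⁻¹| :=
    (mul_le_mul_of_nonneg_left (le_abs_self _) h0.le).trans
      (mul_le_mul_of_nonneg_right (hgB n hn) (abs_nonneg _))
  linarith [Real.add_one_le_exp ((B + 2) * |r n - (g n)⁻¹|)]

/-! ### Lattice distances -/

theorem isMetricFrom_latticeDist {m : ℕ} {w : ℕ → ℝ} (hw : ∀ ℓ, m < ℓ → 0 < w ℓ) :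
    IsMetricFrom m (latticeDist w) := by
  have hmem : ∀ {a b ℓ : ℕ}, m ≤ a → m ≤ b → ℓ ∈ Finset.Ioc (min a b) (max a b) → 0 < w ℓ := by
    intro a b ℓ ha hb hℓ
    rw [Finset.mem_Ioc] at hℓ
    exact hw ℓ (by omega)
  refine ⟨fun a b ha hb => Finset.sum_nonneg fun ℓ hℓ => (hmem ha hb hℓ).le,
    fun a b ha hb => ⟨fun h => ?_, ?_⟩, fun a b _ _ => ?_, fun a b c ha hb hc => ?_⟩
  · by_contra hne
    refine (Finset.sum_pos (fun ℓ hℓ => hmem ha hb hℓ) ?_).ne' h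
    rw [Finset.nonempty_Ioc]
    omega
  · rintro rfl
    simp [latticeDist]
  · rw [latticeDist, latticeDist, min_comm, max_comm]
  · have hsub : Finset.Ioc (min a c) (max a c) ⊆
        Finset.Ioc (min a b) (max a b) ∪ Finset.Ioc (min b c) (max b c) := by
      intro ℓ
      simp only [Finset.mem_union, Finset.mem_Ioc]
      omega
    have hpos : ∀ ℓ ∈ Finset.Ioc (min a b) (max a b) ∪ Finset.Ioc (min b c) (max b c),
        0 < w ℓ := by
      intro ℓ hℓ
      rcases Finset.mem_union.1 hℓ with h | h
      exacts [hmem ha hb h, hmem hb hc h]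
    have h1 := Finset.sum_le_sum_of_subset_of_nonneg (f := w) hsub fun ℓ hℓ _ => (hpos ℓ hℓ).le
    have h2 := Finset.sum_union_inter (f := w) (s₁ := Finset.Ioc (min a b) (max a b))
      (s₂ := Finset.Ioc (min b c) (max b c))
    have h3 : 0 ≤ ∑ ℓ ∈ Finset.Ioc (min a b) (max a b) ∩ Finset.Ioc (min b c) (max b c), w ℓ :=
      Finset.sum_nonneg fun ℓ hℓ => (hmem ha hb (Finset.mem_inter.1 hℓ).1).le
    simp only [latticeDist]
    linarith

theorem exp_latticeDist_log {m n : ℕ} (hmn : m ≤ n) {w g : ℕ → ℝ}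
    (hg : ∀ ℓ, m < ℓ → Real.exp (w ℓ) = g ℓ) :
    Real.exp (latticeDist w m n) = ∏ ℓ ∈ Finset.Icc (m + 1) n, g ℓ := by
  rw [latticeDist, min_eq_left hmn, max_eq_right hmn, Real.exp_sum]
  refine Finset.prod_congr ?_ fun ℓ hℓ => hg ℓ ?_
  · ext ℓ
    simp only [Finset.mem_Ioc, Finset.mem_Icc]
    omega
  · rw [Finset.mem_Icc] at hℓ
    omega

/-! ### Transfer of bounds and the main theorem -/

theorem memℓp_infty_of_norm_eq {E F : Type*} [NormedAddCommGroup E] [NormedAddCommGroup F]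
    {f : ℕ → E} {g : ℕ → F} (hf : Memℓp f ∞) {m : ℕ} (h : ∀ n, m ≤ n → ‖g n‖ = ‖f n‖) :
    Memℓp g ∞ := by
  obtain ⟨B, hB⟩ := memℓp_infty_iff.1 hf
  refine memℓp_infty_of_eventually_le (B := B) ?_
  filter_upwards [eventually_ge_atTop m] with n hn
  rw [h n hn]
  exact hB ⟨n, rfl⟩

theorem eventually_abs_le_of_memℓp_two {φ : ℕ → ℝ} (h : Memℓp φ 2) :
    ∃ B, ∀ᶠ n in atTop, |φ n| ≤ B := by
  obtain ⟨B, hB⟩ := memℓp_infty_iff.1 (h.of_exponent_ge le_top)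
  exact ⟨B, Eventually.of_forall fun n => hB ⟨n, rfl⟩⟩

theorem mainTheorem3 (V : ℕ → ℝ) (C : ℝ) (hC : 0 < C)
    (hV : (C : EReal) < Filter.liminf (fun n : ℕ => (V n : EReal)) Filter.atTop) :
    -- the subdominant solution exists and is unique up to a nonzero factor
    (∃ φ₀ : ℕ → ℝ, ∀ φ : ℕ → ℝ, IsSubdominant V φ ↔ ∃ c : ℝ, c ≠ 0 ∧ φ = c • φ₀) ∧
    -- the bounds (a) and (b)
    (∀ φ : ℕ → ℝ, IsSubdominant V φ → ∀ m : ℕ, 1 ≤ m →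
      Memℓp (fun n : ℕ => (∏ ℓ ∈ Finset.Icc m n, (V ℓ + 2) / agmonConst C) * φ n) ∞ ∧
      (Memℓp (fun n : ℕ => (n : ℝ) * (V (n + 1) - V n)) 1 →
        Memℓp (fun n : ℕ => (∏ ℓ ∈ Finset.Icc m n, growthFactor (V ℓ)) * (φ n : ℂ)) ∞)) ∧
    -- the resulting Agmon distances, on any half-line where the logarithms make sense
    (∀ m : ℕ, (∀ ℓ : ℕ, m < ℓ → 0 < V ℓ) →
      (HasAgmonDecay V m
          (latticeDist fun ℓ => Real.log (V ℓ + 2) - Real.log (agmonConst C)) ∧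
        ((∀ ℓ : ℕ, m < ℓ → agmonConst C < V ℓ + 2) →
          IsMetricFrom m
            (latticeDist fun ℓ => Real.log (V ℓ + 2) - Real.log (agmonConst C)))) ∧
      (Memℓp (fun n : ℕ => (n : ℝ) * (V (n + 1) - V n)) 1 →
        HasAgmonDecay V m
            (latticeDist fun ℓ => Real.log ((V ℓ + 2 + √(V ℓ * (V ℓ + 4))) / 2)) ∧
          IsMetricFrom m
            (latticeDist fun ℓ => Real.log ((V ℓ + 2 + √(V ℓ * (V ℓ + 4))) / 2)))) := by
  obtain ⟨N, hN⟩ : ∃ N : ℕ, ∀ n, N ≤ n → C < V n := by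
    have h := eventually_lt_of_lt_liminf hV
    obtain ⟨N, hN⟩ := eventually_atTop.1 h
    exact ⟨N, fun n hn => EReal.coe_lt_coe_iff.1 (hN n hn)⟩
  obtain ⟨φ₀, u, hφ₀, hu, hW, hpos, hanti, htop⟩ :=
    exists_fundamentalSystem fun n hn => (hC.trans (hN n hn)).le
  have hbdd : ∀ ψ, IsSchrodingerSolution V ψ → (∃ B, ∀ᶠ n in atTop, |ψ n| ≤ B) →
      ∃ c : ℝ, ψ = c • φ₀ := fun ψ hψ ⟨_, hB⟩ =>
    eq_smul_of_bounded hφ₀ hu hW hpos hanti htop hψ hB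
  have hsub : ∀ φ, IsSubdominant V φ → ∃ c : ℝ, c ≠ 0 ∧ φ = c • φ₀ := by
    rintro φ ⟨hφ, hne, M, hM⟩
    obtain ⟨c, rfl⟩ := hbdd φ hφ ⟨|φ M|, by
      filter_upwards [eventually_ge_atTop M] with n hn
      exact hM (Set.mem_Ici.2 le_rfl) (Set.mem_Ici.2 hn) hn⟩
    refine ⟨c, ?_, rfl⟩
    rintro rfl
    exact hne (zero_smul _ _)
  have ha : ∀ (c : ℝ) (m : ℕ),
      Memℓp (fun n => (∏ ℓ ∈ Finset.Icc m n, (V ℓ + 2) / agmonConst C) * (c • φ₀) n) ∞ := by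
    intro c m
    have h := (memℓp_prod_div_agmonConst hC hN hφ₀ hpos hanti m).const_smul c
    refine memℓp_infty_of_norm_eq h (m := 0) fun n _ => congrArg _ ?_
    simp only [Pi.smul_apply, smul_eq_mul]
    ring
  have hb : Memℓp (fun n : ℕ => (n : ℝ) * (V (n + 1) - V n)) 1 → ∀ (c : ℝ) (m : ℕ),
      Memℓp (fun n => (∏ ℓ ∈ Finset.Icc m n, growthFactor (V ℓ)) * ((c • φ₀) n : ℂ)) ∞ := by
    intro h c m
    have h1 := (memℓp_prod_growthFactor hC hN hφ₀ hpos hanti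
      (summable_abs_succ_sub h) m).const_smul (c : ℂ)
    refine memℓp_infty_of_norm_eq h1 (m := 0) fun n _ => congrArg _ ?_
    simp only [Pi.smul_apply, smul_eq_mul, Complex.ofReal_mul]
    ring
  refine ⟨⟨φ₀, fun φ => ⟨hsub φ, ?_⟩⟩, ?_, ?_⟩
  · rintro ⟨c, hc, rfl⟩
    refine ⟨?_, ?_, N, ?_⟩
    · convert hφ₀.linearCombination hφ₀ c 0 using 2 with n
      simp
    · intro h
      exact mul_ne_zero hc (hpos N le_rfl).ne' (congrFun h N)
    · refine antitoneOn_nat_Ici_of_succ_le fun n hn => ?_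
      simp only [Pi.smul_apply, smul_eq_mul, abs_mul]
      rw [abs_of_pos (hpos n hn), abs_of_pos (hpos (n + 1) (by omega))]
      exact mul_le_mul_of_nonneg_left (hanti n hn) (abs_nonneg c)
  · intro φ hφ m _
    obtain ⟨c, -, rfl⟩ := hsub φ hφ
    exact ⟨ha c m, fun h => hb h c m⟩
  · intro m hm
    have hK := agmonConst_pos hC
    refine ⟨⟨?_, fun hmK => isMetricFrom_latticeDist fun ℓ hℓ =>
      sub_pos.2 (Real.log_lt_log hK (hmK ℓ hℓ))⟩, fun h => ⟨?_, ?_⟩⟩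
    · intro φ hφ hφ2
      obtain ⟨c, rfl⟩ := hbdd φ hφ (eventually_abs_le_of_memℓp_two hφ2)
      -- The distance from `m` omits the weight at `m`, so the product starts at `m + 1`.
      refine memℓp_infty_of_norm_eq (ha c (m + 1)) (m := m) fun n hn => ?_
      rw [exp_latticeDist_log hn fun ℓ hℓ => ?_]
      have hVℓ := hm ℓ hℓ
      rw [Real.exp_sub, Real.exp_log (by linarith), Real.exp_log hK]
    · intro φ hφ hφ2
      obtain ⟨c, rfl⟩ := hbdd φ hφ (eventually_abs_le_of_memℓp_two hφ2)
      refine memℓp_infty_of_norm_eq (hb h c (m + 1)) (m := m) fun n hn => ?_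
      have hexp := exp_latticeDist_log (g := fun ℓ => realGrowthFactor (V ℓ)) hn
        fun ℓ hℓ => Real.exp_log (realGrowthFactor_pos (hm ℓ hℓ).le)
      simp only [realGrowthFactor] at hexp
      rw [hexp]
      have hprod : ∏ ℓ ∈ Finset.Icc (m + 1) n, growthFactor (V ℓ) =
          ((∏ ℓ ∈ Finset.Icc (m + 1) n, realGrowthFactor (V ℓ) : ℝ) : ℂ) := by
        rw [Complex.ofReal_prod]
        refine Finset.prod_congr rfl fun ℓ hℓ => growthFactor_eq_ofReal (hm ℓ ?_).le
        rw [Finset.mem_Icc] at hℓ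
        omega
      rw [hprod, ← Complex.ofReal_mul, Complex.norm_real]
      rfl
    · exact isMetricFrom_latticeDist fun ℓ hℓ =>
        Real.log_pos (one_lt_realGrowthFactor (hm ℓ hℓ))
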